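/- Let $d\ge 1$, let $X\subset\mathbb R^d$ be compact and convex with nonempty interior, and let $V\supseteq X$ be a bounded, connected open set. For every $n\ge 1$ let $I^{(n)}$ be a finite nonempty alphabet and let $\varphi^{(n)}_a\colon V\to V$, $a\in I^{(n)}$, be injective conformal maps (at every point of $V$ the derivative exists and is a similarity with nonzero ratio) such that $\varphi^{(n)}_a(X)\subseteq X$. For $f\colon V\to V$ differentiable write $\|Df\|=\sup_{x\in X}|Df(x)|$, and for $\omega=(\omega_1,\dots,\omega_n)\in I^n:=I^{(1)}\times\dots\times I^{(n)}$ put $\varphi^n_\omega=\varphi^{(1)}_{\omega_1}\circ\dots\circ\varphi^{(n)}_{\omega_n}$. Assume: * (uniform contraction) there is $\theta>0$ with $\|D\varphi^{(n)}_a\|\le e^{-\theta}$ for all $n\ge 1$ and $a\in I^{(n)}$; * (open set condition) $\varphi^{(n)}_a(\operatorname{int}X)\cap\varphi^{(n)}_b(\operatorname{int}X)=\emptyset$ for all $n\ge 1$ and $a\ne b$ in $I^{(n)}$; * (bounded distortion) there is $K\ge1$ with $|D\varphi^n_\omega(x)|\le K\,|D\varphi^n_\omega(y)|$ for all $n\ge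 1$, $\omega\in I^n$ and $x,y\in X$. Let $J=\bigcap_{n\ge1}\bigcup_{\omega\in I^n}\varphi^n_\omega(X)$ be the limit set and put $$\rho_n=\max_{a,b\in I^{(n)}}\frac{\|D\varphi^{(n)}_a\|}{\|D\varphi^{(n)}_b\|},\qquad Z_n(t)=\sum_{\omega\in I^n}\|D\varphi^n_\omega\|^t .$$ **Theorem.** Let $h\ge0$ be a real number such that the sequences $(\#I^{(n)})_{n\ge1}$, $(\rho_n)_{n\ge1}$, $(Z_n(h))_{n\ge1}$ and $(Z_n(h)^{-1})_{n\ge1}$ are bounded. Then there is a Borel probability measure $\mu$ on $\mathbb R^d$ with $\operatorname{supp}\mu=J$ that is $h$-Ahlfors regular: there is $C\ge1$ such that $C^{-1}r^h\le\mu(B(x,r))\le C\,r^h$ for all $x\in\operatorname{supp}\mu$ and $0<r\le1$. Moreover, $\mu$ is obtained as a weak limit, as follows. There are Borel probability measures $\mu^{(n)}$ such that, for every $n$, $\mu^{(n)}$ is carried by $\bigcup_{\omega\in I^n}\varphi^n_\omega(X)$ and $$\mu^{(n)}(\varphi^n_\omega(X))=\frac{\|D\varphi^n_\omega\|^h}{Z_n(h)}\qquad\text{for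 all }\omega\in I^n ,$$ and such that some subsequence of $(\mu^{(n)})$ converges weakly to a measure $\mu$ as above; and for every sequence $(\mu^{(n)})$ of such measures, every weak limit of a subsequence is an $h$-Ahlfors regular probability measure with support $J$. -/

import Mathlib

open Set Filter Topology MeasureTheory

universe u

/-- The supremum norm over `X` of the derivative of `f`. -/
noncomputable def derivNorm {d : ℕ} (X : Set (EuclideanSpace ℝ (Fin d)))
    (f : EuclideanSpace ℝ (Fin d) → EuclideanSpace ℝ (Fin d)) : ℝ :=
  ⨆ x : X, ‖fderiv ℝ f (x : EuclideanSpace ℝ (Fin d))‖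

/-- A nonautonomous conformal iterated function system. The `n`-th alphabet, `n ≥ 1`, is
`I (n - 1)`. The maps are total functions, of which only the values on `V` matter. -/
structure ConformalNIFS (d : ℕ) (I : ℕ → Type u) where
  X : Set (EuclideanSpace ℝ (Fin d))
  V : Set (EuclideanSpace ℝ (Fin d))
  isCompact_X : IsCompact X
  convex_X : Convex ℝ X
  interior_X_nonempty : (interior X).Nonempty
  isOpen_V : IsOpen V
  isBounded_V : Bornology.IsBounded V
  isConnected_V : IsConnected V
  X_subset_V : X ⊆ V
  φ : (n : ℕ) → I n → EuclideanSpace ℝ (Fin d) → EuclideanSpace ℝ (Fin d)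
  mapsTo_V : ∀ n j, MapsTo (φ n j) V V
  mapsTo_X : ∀ n j, MapsTo (φ n j) X X
  /-- At every point of `V` the derivative exists and is a similarity with nonzero ratio. -/
  conformal : ∀ n j, ∀ x ∈ V, ConformalAt (φ n j) x
  contracting : ∃ θ : ℝ, 0 < θ ∧ ∀ n j, ∀ x ∈ X, ‖fderiv ℝ (φ n j) x‖ ≤ Real.exp (-θ)

namespace ConformalNIFS

variable {d : ℕ} {I : ℕ → Type u} (Φ : ConformalNIFS d I)

/-- Words of length `n`: the product of the first `n` alphabets. -/
abbrev Word (I : ℕ → Type u) (n : ℕ) : Type u := (k : Fin n) → I k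

/-- The composition of the maps along a word, the last letter being applied first. -/
def wordMap : (n : ℕ) → Word I n → EuclideanSpace ℝ (Fin d) → EuclideanSpace ℝ (Fin d)
  | 0, _ => id
  | n + 1, ω => wordMap n (fun k => ω k.castSucc) ∘ Φ.φ n (ω (Fin.last n))

/-- The cylinder of a word: the image of `X` under the map of that word. -/
def cylinder (n : ℕ) (ω : Word I n) : Set (EuclideanSpace ℝ (Fin d)) :=
  Φ.wordMap n ω '' Φ.X

/-- The limit set `J`. -/
def limitSet : Set (EuclideanSpace ℝ (Fin d)) :=
  ⋂ (n : ℕ) (_ : 1 ≤ n), ⋃ ω : Word I n, Φ.cylinder n ω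

/-- All maps of the system are injective on `V`. -/
def IsInjective : Prop := ∀ n j, InjOn (Φ.φ n j) Φ.V

/-- The open set condition. -/
def OpenSetCondition : Prop :=
  ∀ n, ∀ i j : I n, i ≠ j → Φ.φ n j '' interior Φ.X ∩ Φ.φ n i '' interior Φ.X = ∅

/-- The bounded distortion property. -/
def BoundedDistortion : Prop :=
  ∃ K : ℝ, 1 ≤ K ∧ ∀ (n : ℕ) (ω : Word I n), ∀ x ∈ Φ.X, ∀ y ∈ Φ.X,
    ‖fderiv ℝ (Φ.wordMap n ω) x‖ ≤ K * ‖fderiv ℝ (Φ.wordMap n ω) y‖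

/-- The largest ratio of two derivative norms in one alphabet (a maximum over a finite set). -/
noncomputable def ρ (n : ℕ) : ℝ :=
  ⨆ p : I n × I n, derivNorm Φ.X (Φ.φ n p.1) / derivNorm Φ.X (Φ.φ n p.2)

/-- The partition function: the sum over words of length `n` of the `t`-th powers of the
derivative norms. -/
noncomputable def Z [∀ n, Fintype (I n)] (n : ℕ) (t : ℝ) : ℝ :=
  ∑ ω : Word I n, derivNorm Φ.X (Φ.wordMap n ω) ^ t

/-- `ν` lives on the union of the cylinders of level `n` and gives each of them the mass that is
proportional to the `t`-th power of its derivative norm. -/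
def IsCylinderMeasure [∀ n, Fintype (I n)] (t : ℝ) (n : ℕ)
    (ν : Measure (EuclideanSpace ℝ (Fin d))) : Prop :=
  ν (⋃ ω : Word I n, Φ.cylinder n ω)ᶜ = 0 ∧
    ∀ ω : Word I n,
      ν (Φ.cylinder n ω) = ENNReal.ofReal (derivNorm Φ.X (Φ.wordMap n ω) ^ t / Φ.Z n t)

end ConformalNIFS

/-- Ahlfors regularity of exponent `h`. -/
def IsAhlforsRegular {d : ℕ} (h : ℝ) (μ : Measure (EuclideanSpace ℝ (Fin d))) : Prop :=
  ∃ C : ℝ, 1 ≤ C ∧ ∀ x ∈ μ.support, ∀ r : ℝ, 0 < r → r ≤ 1 →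
    ENNReal.ofReal (C⁻¹ * r ^ h) ≤ μ (Metric.ball x r) ∧
      μ (Metric.ball x r) ≤ ENNReal.ofReal (C * r ^ h)

/-! ### Conformal linear maps, covering of balls, volume packing. -/

section Conformal

variable {E F : Type*} [NormedAddCommGroup E] [NormedSpace ℝ E]
  [NormedAddCommGroup F] [NormedSpace ℝ F]

/-! Give a word τ of length n the weight ‖Dφ_τ‖^h / Z_n(h). These weights are consistent between
levels up to a constant: the extensions to length n of a word σ carry, in total, the weight of σ up
to a factor K^(2h), independent of n (`sum_extensions_le`, `le_sum_extensions`). As Z_n(h) stays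
away from 0 and ∞, a cylinder of any lower level has mass comparable to ‖Dφ_σ‖^h, for all cylinder
measures of high level.

To estimate a ball of radius r, cut each word at its first initial subword of norm at most r. Letter
norms cannot be too small (`exists_le_rpow_letterNorm`), so the norm of the cut word, raised to the
power h, is comparable to r^h (`exists_take_stopping`). The images of int X under distinct cut words
are disjoint and, when h > 0, contain balls of radius comparable to r, so by volume boundedly many
of their cylinders meet the ball (`exists_card_stopping_le`). This is the upper bound. For the lower
bound, at a point of J, one cut cylinder around the point and inside the ball suffices. Both bounds
hold for all large n, hence pass to weak limits; the lower one and the nesting of levels identify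
the support. -/

theorem IsConformalMap.norm_apply {L : E →L[ℝ] F} (hL : IsConformalMap L) (v : E) :
    ‖L v‖ = ‖L‖ * ‖v‖ := by
  obtain ⟨c, -, li, rfl⟩ := hL
  rcases subsingleton_or_nontrivial E with hE | hE
  · simp [Subsingleton.elim v 0]
  · have : ‖li.toContinuousLinearMap‖ = 1 := li.norm_toContinuousLinearMap
    simp [norm_smul, this]

theorem IsConformalMap.norm_pos [Nontrivial E] {L : E →L[ℝ] F} (hL : IsConformalMap L) :
    0 < ‖L‖ := by
  obtain ⟨c, hc, li, rfl⟩ := hL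
  have : ‖li.toContinuousLinearMap‖ = 1 := li.norm_toContinuousLinearMap
  simp [norm_smul, this, hc]

theorem IsConformalMap.norm_comp {G : Type*} [NormedAddCommGroup G] [NormedSpace ℝ G]
    [Nontrivial E] {M : F →L[ℝ] G} {L : E →L[ℝ] F} (hM : IsConformalMap M)
    (hL : IsConformalMap L) : ‖M.comp L‖ = ‖M‖ * ‖L‖ := by
  obtain ⟨v, hv⟩ := exists_ne (0 : E)
  have h := (hM.comp hL).norm_apply v
  rw [ContinuousLinearMap.comp_apply, hM.norm_apply, hL.norm_apply, ← mul_assoc] at h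
  exact (mul_right_cancel₀ (norm_ne_zero_iff.2 hv) h).symm

theorem IsConformalMap.surjective [FiniteDimensional ℝ E] {L : E →L[ℝ] E}
    (hL : IsConformalMap L) : Function.Surjective L := by
  have : Function.Injective L.toLinearMap := hL.injective
  exact LinearMap.injective_iff_surjective.1 this

/-- A map that is conformal on a ball, with dilatation at least `l`, covers the ball of the
correspondingly scaled radius around the image of the centre. -/
theorem ball_subset_image_ball_of_conformalAt [FiniteDimensional ℝ E] {f : E → E} {x₀ : E}
    {R l : ℝ} (hR : 0 < R)
    (hf : ∀ x ∈ Metric.closedBall x₀ R, ConformalAt f x)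
    (hfl : ∀ x ∈ Metric.closedBall x₀ R, l ≤ ‖fderiv ℝ f x‖) :
    Metric.ball (f x₀) (l * R) ⊆ f '' Metric.ball x₀ R := by
  intro y hy
  have hy' : ‖f x₀ - y‖ < l * R := by rwa [mem_ball_iff_norm, norm_sub_rev] at hy
  -- The derivative need not be continuous, so a minimum of ‖f x - y‖ + ε‖x - x₀‖ replaces the
  -- inverse function theorem. The lower bound on ε keeps the minimiser off the sphere; ε < l makes
  -- the penalty too weak to stop a move of f x towards y.
  obtain ⟨ε, hε1, hε2⟩ : ∃ ε, ‖f x₀ - y‖ / R < ε ∧ ε < l :=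
    exists_between ((div_lt_iff₀ hR).2 hy')
  have hε0 : 0 < ε := lt_of_le_of_lt (by positivity) hε1
  rw [div_lt_iff₀ hR] at hε1
  have hcont : ContinuousOn (fun x => ‖f x - y‖ + ε * ‖x - x₀‖) (Metric.closedBall x₀ R) := by
    have : ContinuousOn f (Metric.closedBall x₀ R) := fun x hx =>
      (hf x hx).differentiableAt.continuousAt.continuousWithinAt
    fun_prop
  obtain ⟨x, hx, hmin⟩ := (isCompact_closedBall x₀ R).exists_isMinOn
    (Metric.nonempty_closedBall.2 hR.le) hcont
  have hxR : x ∈ Metric.ball x₀ R := by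
    have h0 := hmin (Metric.mem_closedBall_self hR.le)
    simp only [Set.mem_ofPred_eq, sub_self, norm_zero, mul_zero, add_zero] at h0
    rw [mem_ball_iff_norm]
    by_contra! hge
    nlinarith [norm_nonneg (f x - y), mul_le_mul_of_nonneg_left hge hε0.le]
  refine ⟨x, hxR, ?_⟩
  by_contra hne
  have hu : 0 < ‖y - f x‖ := norm_pos_iff.2 (sub_ne_zero.2 (Ne.symm hne))
  have hconf := conformalAt_iff_isConformalMap_fderiv.1 (hf x hx)
  obtain ⟨v, hv⟩ := hconf.surjective (y - f x)
  have hvn : l * ‖v‖ ≤ ‖y - f x‖ := by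
    rw [← hv, hconf.norm_apply]
    exact mul_le_mul_of_nonneg_right (hfl x hx) (norm_nonneg v)
  have hv0 : 0 < ‖v‖ := norm_pos_iff.2 (by rintro rfl; simp [← hv] at hu)
  have hεv : ε * ‖v‖ < ‖y - f x‖ := (mul_lt_mul_of_pos_right hε2 hv0).trans_le hvn
  -- Half the net rate of decrease in direction v; a linearisation error below η t still contradicts
  -- minimality.
  set η := (‖y - f x‖ - ε * ‖v‖) / 2 with hη
  have hη0 : 0 < η := by rw [hη]; linarith
  have hder : HasDerivAt (fun t : ℝ => f (x + t • v)) (y - f x) 0 := by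
    have hlin : HasDerivAt (fun t : ℝ => x + t • v) v 0 := by
      simpa using ((hasDerivAt_id (0 : ℝ)).smul_const v).const_add x
    have h1 : HasFDerivAt f (fderiv ℝ f x) (x + (0 : ℝ) • v) := by
      simpa using (hf x hx).differentiableAt.hasFDerivAt
    rw [← hv]
    exact h1.comp_hasDerivAt (0 : ℝ) hlin
  have hlittle := (hasDerivAt_iff_isLittleO.1 hder).def hη0
  have hball : ∀ᶠ t : ℝ in 𝓝 0, x + t • v ∈ Metric.closedBall x₀ R := by
    have : Tendsto (fun t : ℝ => x + t • v) (𝓝 0) (𝓝 x) := by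
      have : Continuous fun t : ℝ => x + t • v := by fun_prop
      simpa using this.tendsto 0
    exact this.eventually (Filter.mem_of_superset (Metric.isOpen_ball.mem_nhds hxR)
      Metric.ball_subset_closedBall)
  obtain ⟨t, ht0, ht1, hA, hB⟩ : ∃ t : ℝ, 0 < t ∧ t < 1 ∧
      ‖f (x + t • v) - f (x + (0 : ℝ) • v) - (t - 0) • (y - f x)‖ ≤ η * ‖t - 0‖ ∧
      x + t • v ∈ Metric.closedBall x₀ R := by
    have hgt : ∀ᶠ t : ℝ in 𝓝[>] 0, 0 < t ∧ t < 1 := by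
      filter_upwards [Ioo_mem_nhdsGT (zero_lt_one (α := ℝ))] with t ht using ht
    obtain ⟨t, ⟨h1, h2⟩, h3, h4⟩ :=
      (hgt.and ((hlittle.and hball).filter_mono nhdsWithin_le_nhds)).exists
    exact ⟨t, h1, h2, h3, h4⟩
  have hle := hmin hB
  simp only [Set.mem_ofPred_eq] at hle
  rw [zero_smul, add_zero, sub_zero, Real.norm_of_nonneg ht0.le] at hA
  have h1 : ‖f (x + t • v) - y‖ ≤ η * t + (1 - t) * ‖y - f x‖ := by
    have : f (x + t • v) - y = (f (x + t • v) - f x - t • (y - f x)) - (1 - t) • (y - f x) := by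
      module
    rw [this]
    refine (norm_sub_le _ _).trans (add_le_add hA ?_)
    rw [norm_smul, Real.norm_of_nonneg (by linarith)]
  have h2 : ‖x + t • v - x₀‖ ≤ ‖x - x₀‖ + t * ‖v‖ := by
    have : x + t • v - x₀ = (x - x₀) + t • v := by abel
    rw [this]
    refine (norm_add_le _ _).trans (le_of_eq ?_)
    rw [norm_smul, Real.norm_of_nonneg ht0.le]
  have h3 := mul_le_mul_of_nonneg_left h2 hε0.le
  rw [norm_sub_rev (f x) y] at hle
  have h4 : t * ‖y - f x‖ ≤ t * (η + ε * ‖v‖) := by nlinarith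
  have h5 := le_of_mul_le_mul_left h4 ht0
  rw [hη] at h5
  linarith

/-- Volume bound for the number of disjoint open sets that contain a ball of radius `a` and lie in
a ball of radius `b * a`. -/
theorem card_le_pow_of_disjoint_balls [FiniteDimensional ℝ E] {ι : Type*} (s : Finset ι)
    (U : ι → Set E) (c : ι → E) (x : E) {a b : ℝ} (ha : 0 < a) (hb : 0 < b)
    (hball : ∀ i ∈ s, Metric.ball (c i) a ⊆ U i) (hU : ∀ i ∈ s, U i ⊆ Metric.ball x (b * a))
    (hdisj : (s : Set ι).PairwiseDisjoint U) :
    (s.card : ℝ) ≤ b ^ Module.finrank ℝ E := by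
  borelize E
  let μ : Measure E := Measure.addHaar
  have hd : (s : Set ι).PairwiseDisjoint fun i => Metric.ball (c i) a := fun i hi j hj hij =>
    (hdisj hi hj hij).mono (hball i hi) (hball j hj)
  have h1 : ∑ i ∈ s, μ (Metric.ball (c i) a) ≤ μ (Metric.ball x (b * a)) := by
    rw [← measure_biUnion_finset hd fun i _ => measurableSet_ball]
    exact measure_mono (iUnion₂_subset fun i hi => (hball i hi).trans (hU i hi))
  have hpos : 0 < μ.real (Metric.ball (0 : E) 1) :=
    ENNReal.toReal_pos (Metric.measure_ball_pos μ _ one_pos).ne' measure_ball_lt_top.ne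
  have h2 : ∑ i ∈ s, μ.real (Metric.ball (c i) a) ≤ μ.real (Metric.ball x (b * a)) := by
    have := ENNReal.toReal_mono measure_ball_lt_top.ne h1
    rwa [ENNReal.toReal_sum fun i _ => measure_ball_lt_top.ne] at this
  simp only [measureReal_def, μ, Measure.addHaar_ball_of_pos _ _ ha,
    Measure.addHaar_ball_of_pos _ _ (mul_pos hb ha), ENNReal.toReal_mul] at h2
  rw [ENNReal.toReal_ofReal (by positivity), ENNReal.toReal_ofReal (by positivity),
    Finset.sum_const, nsmul_eq_mul, mul_pow, ← mul_assoc] at h2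
  have h3 := le_of_mul_le_mul_right h2 hpos
  exact le_of_mul_le_mul_right h3 (by positivity)

end Conformal

/-! ### The supremum norm of the derivative. -/

section DerivNorm

variable {d : ℕ} {X : Set (EuclideanSpace ℝ (Fin d))}
  {f : EuclideanSpace ℝ (Fin d) → EuclideanSpace ℝ (Fin d)} {C : ℝ}

theorem derivNorm_nonneg : 0 ≤ derivNorm X f :=
  Real.iSup_nonneg fun _ => norm_nonneg _

theorem derivNorm_le (hC : ∀ x ∈ X, ‖fderiv ℝ f x‖ ≤ C) (hX : X.Nonempty) :
    derivNorm X f ≤ C :=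
  have := hX.to_subtype
  ciSup_le fun x => hC x x.2

theorem norm_fderiv_le_derivNorm (hC : ∀ x ∈ X, ‖fderiv ℝ f x‖ ≤ C)
    {x : EuclideanSpace ℝ (Fin d)} (hx : x ∈ X) : ‖fderiv ℝ f x‖ ≤ derivNorm X f :=
  le_ciSup (f := fun x : X => ‖fderiv ℝ f (x : EuclideanSpace ℝ (Fin d))‖)
    ⟨C, by rintro _ ⟨y, rfl⟩; exact hC y y.2⟩ ⟨x, hx⟩

end DerivNorm

/-! ### Words, cylinders and their geometry under bounded distortion. -/

namespace ConformalNIFS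

variable {d : ℕ} {I : ℕ → Type u} (Φ : ConformalNIFS d I)

/-- The initial subword of length `k`. -/
def Word.take {k n : ℕ} (hkn : k ≤ n) (τ : Word I n) : Word I k := fun i => τ (Fin.castLE hkn i)

theorem Word.take_take {j k n : ℕ} (hjk : j ≤ k) (hkn : k ≤ n) (τ : Word I n) :
    Word.take hjk (Word.take hkn τ) = Word.take (hjk.trans hkn) τ := rfl

theorem nonempty_X : Φ.X.Nonempty := Φ.interior_X_nonempty.mono interior_subset

theorem wordMap_succ {n : ℕ} (τ : Word I (n + 1)) :
    Φ.wordMap (n + 1) τ = Φ.wordMap n (Word.take n.le_succ τ) ∘ Φ.φ n (τ (Fin.last n)) := rfl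

theorem wordMap_zero (τ : Word I 0) : Φ.wordMap 0 τ = id := rfl

theorem mapsTo_wordMap_X {n : ℕ} (τ : Word I n) : MapsTo (Φ.wordMap n τ) Φ.X Φ.X := by
  induction n with
  | zero => exact mapsTo_id _
  | succ n ih => exact (ih _).comp (Φ.mapsTo_X n _)

theorem conformalAt_wordMap {n : ℕ} (τ : Word I n) {x : EuclideanSpace ℝ (Fin d)} (hx : x ∈ Φ.V) :
    ConformalAt (Φ.wordMap n τ) x := by
  induction n generalizing x with
  | zero => exact conformalAt_id x
  | succ n ih =>
    exact ConformalAt.comp x (ih _ (Φ.mapsTo_V n _ hx)) (Φ.conformal n _ x hx)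

theorem continuousOn_wordMap {n : ℕ} (τ : Word I n) : ContinuousOn (Φ.wordMap n τ) Φ.V :=
  fun _ hx => (Φ.conformalAt_wordMap τ hx).differentiableAt.continuousAt.continuousWithinAt

variable {Φ} in
theorem IsInjective.injOn_wordMap (hinj : Φ.IsInjective) {n : ℕ} (τ : Word I n) :
    InjOn (Φ.wordMap n τ) Φ.V := by
  induction n with
  | zero => exact injOn_id _
  | succ n ih => exact (ih _).comp (hinj n _) (Φ.mapsTo_V n _)

/-- Extending a word composes on the inside. The set A is kept general to serve for both X and its
interior. -/
theorem image_wordMap_subset_take {A : Set (EuclideanSpace ℝ (Fin d))}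
    (hA : ∀ n a, MapsTo (Φ.φ n a) A A) {k n : ℕ} (hkn : k ≤ n) (τ : Word I n) :
    Φ.wordMap n τ '' A ⊆ Φ.wordMap k (Word.take hkn τ) '' A := by
  induction n, hkn using Nat.le_induction with
  | base => exact Subset.rfl
  | succ n hkn ih =>
    refine Subset.trans ?_ (ih (Word.take n.le_succ τ))
    rw [wordMap_succ, image_comp]
    exact image_mono (hA n _).image_subset

theorem cylinder_subset_take {k n : ℕ} (hkn : k ≤ n) (τ : Word I n) :
    Φ.cylinder n τ ⊆ Φ.cylinder k (Word.take hkn τ) :=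
  Φ.image_wordMap_subset_take Φ.mapsTo_X hkn τ

theorem cylinder_subset_X {n : ℕ} (τ : Word I n) : Φ.cylinder n τ ⊆ Φ.X :=
  (Φ.mapsTo_wordMap_X τ).image_subset

theorem isCompact_cylinder {n : ℕ} (τ : Word I n) : IsCompact (Φ.cylinder n τ) :=
  Φ.isCompact_X.image_of_continuousOn ((Φ.continuousOn_wordMap τ).mono Φ.X_subset_V)

/-- The union of the cylinders of level `n`. -/
def level (n : ℕ) : Set (EuclideanSpace ℝ (Fin d)) := ⋃ ω : Word I n, Φ.cylinder n ω

theorem level_antitone : Antitone Φ.level := fun _ _ hkn =>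
  iUnion_subset fun τ => (Φ.cylinder_subset_take hkn τ).trans (subset_iUnion (Φ.cylinder _) _)

theorem level_subset_X (n : ℕ) : Φ.level n ⊆ Φ.X :=
  iUnion_subset fun τ => Φ.cylinder_subset_X τ

theorem isCompact_level [∀ n, Fintype (I n)] (n : ℕ) : IsCompact (Φ.level n) :=
  isCompact_iUnion fun τ => Φ.isCompact_cylinder τ

theorem limitSet_subset_level (n : ℕ) : Φ.limitSet ⊆ Φ.level n := fun _ hx =>
  Φ.level_antitone n.le_succ (mem_iInter₂.1 hx (n + 1) (Nat.le_add_left _ _))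

theorem mem_limitSet_iff {x : EuclideanSpace ℝ (Fin d)} :
    x ∈ Φ.limitSet ↔ ∀ n, x ∈ Φ.level n :=
  ⟨fun hx n => Φ.limitSet_subset_level n hx, fun hx => mem_iInter₂.2 fun n _ => hx n⟩

/-- The supremum norm over `X` of the derivative of the map of a word. -/
noncomputable def wordNorm {n : ℕ} (ω : Word I n) : ℝ := derivNorm Φ.X (Φ.wordMap n ω)

theorem wordNorm_nonneg {n : ℕ} (ω : Word I n) : 0 ≤ Φ.wordNorm ω := derivNorm_nonneg

/-- The bounded distortion property with constant `K`. -/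
def DistortionBound (K : ℝ) : Prop :=
  1 ≤ K ∧ ∀ (n : ℕ) (ω : Word I n), ∀ x ∈ Φ.X, ∀ y ∈ Φ.X,
    ‖fderiv ℝ (Φ.wordMap n ω) x‖ ≤ K * ‖fderiv ℝ (Φ.wordMap n ω) y‖

theorem norm_fderiv_letter_le (n : ℕ) (a : I n) {x : EuclideanSpace ℝ (Fin d)} (hx : x ∈ Φ.X) :
    ‖fderiv ℝ (Φ.φ n a) x‖ ≤ derivNorm Φ.X (Φ.φ n a) :=
  let ⟨_, _, hθ⟩ := Φ.contracting
  norm_fderiv_le_derivNorm (hθ n a) hx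

theorem norm_fderiv_wordMap_succ [Nontrivial (EuclideanSpace ℝ (Fin d))] {n : ℕ}
    (τ : Word I (n + 1)) {x : EuclideanSpace ℝ (Fin d)} (hx : x ∈ Φ.V) :
    ‖fderiv ℝ (Φ.wordMap (n + 1) τ) x‖ =
      ‖fderiv ℝ (Φ.wordMap n (Word.take n.le_succ τ)) (Φ.φ n (τ (Fin.last n)) x)‖ *
        ‖fderiv ℝ (Φ.φ n (τ (Fin.last n))) x‖ := by
  have h1 := Φ.conformal n (τ (Fin.last n)) x hx
  have h2 := Φ.conformalAt_wordMap (Word.take n.le_succ τ) (Φ.mapsTo_V n (τ (Fin.last n)) hx)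
  rw [wordMap_succ, fderiv_comp x h2.differentiableAt h1.differentiableAt]
  exact (conformalAt_iff_isConformalMap_fderiv.1 h2).norm_comp
    (conformalAt_iff_isConformalMap_fderiv.1 h1)

theorem norm_fderiv_wordMap_pos [Nontrivial (EuclideanSpace ℝ (Fin d))] {n : ℕ} (τ : Word I n)
    {x : EuclideanSpace ℝ (Fin d)} (hx : x ∈ Φ.X) : 0 < ‖fderiv ℝ (Φ.wordMap n τ) x‖ :=
  (conformalAt_iff_isConformalMap_fderiv.1
    (Φ.conformalAt_wordMap τ (Φ.X_subset_V hx))).norm_pos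

theorem letterNorm_pos [Nontrivial (EuclideanSpace ℝ (Fin d))] (n : ℕ) (a : I n) :
    0 < derivNorm Φ.X (Φ.φ n a) := by
  obtain ⟨x, hx⟩ := Φ.nonempty_X
  exact (conformalAt_iff_isConformalMap_fderiv.1
    (Φ.conformal n a x (Φ.X_subset_V hx))).norm_pos.trans_le (Φ.norm_fderiv_letter_le n a hx)

section Distortion

variable {Φ} {K : ℝ} (hK : Φ.DistortionBound K)
include hK

theorem DistortionBound.norm_fderiv_le {n : ℕ} (τ : Word I n)
    {x : EuclideanSpace ℝ (Fin d)} (hx : x ∈ Φ.X) :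
    ‖fderiv ℝ (Φ.wordMap n τ) x‖ ≤ Φ.wordNorm τ :=
  norm_fderiv_le_derivNorm (fun y hy => hK.2 n τ y hy x hx) hx

theorem DistortionBound.wordNorm_le {n : ℕ} (τ : Word I n)
    {x : EuclideanSpace ℝ (Fin d)} (hx : x ∈ Φ.X) :
    Φ.wordNorm τ ≤ K * ‖fderiv ℝ (Φ.wordMap n τ) x‖ :=
  derivNorm_le (fun y hy => hK.2 n τ y hy x hx) Φ.nonempty_X

theorem DistortionBound.rpow_norm_fderiv_le {h : ℝ} (hh : 0 ≤ h) {n : ℕ} (τ : Word I n)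
    {x : EuclideanSpace ℝ (Fin d)} (hx : x ∈ Φ.X) :
    ‖fderiv ℝ (Φ.wordMap n τ) x‖ ^ h ≤ Φ.wordNorm τ ^ h :=
  Real.rpow_le_rpow (norm_nonneg _) (hK.norm_fderiv_le τ hx) hh

theorem DistortionBound.rpow_wordNorm_le {h : ℝ} (hh : 0 ≤ h) {n : ℕ} (τ : Word I n)
    {x : EuclideanSpace ℝ (Fin d)} (hx : x ∈ Φ.X) :
    Φ.wordNorm τ ^ h ≤ K ^ h * ‖fderiv ℝ (Φ.wordMap n τ) x‖ ^ h := by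
  rw [← Real.mul_rpow (zero_le_one.trans hK.1) (norm_nonneg _)]
  exact Real.rpow_le_rpow derivNorm_nonneg (hK.wordNorm_le τ hx) hh

variable [Nontrivial (EuclideanSpace ℝ (Fin d))]

theorem DistortionBound.wordNorm_pos {n : ℕ} (τ : Word I n) : 0 < Φ.wordNorm τ :=
  let ⟨_, hx⟩ := Φ.nonempty_X
  (Φ.norm_fderiv_wordMap_pos τ hx).trans_le (hK.norm_fderiv_le τ hx)

theorem DistortionBound.wordNorm_succ_le {n : ℕ} (τ : Word I (n + 1)) :
    Φ.wordNorm τ ≤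
      Φ.wordNorm (Word.take n.le_succ τ) * derivNorm Φ.X (Φ.φ n (τ (Fin.last n))) := by
  refine derivNorm_le (fun x hx => ?_) Φ.nonempty_X
  rw [Φ.norm_fderiv_wordMap_succ τ (Φ.X_subset_V hx)]
  exact mul_le_mul (hK.norm_fderiv_le _ (Φ.mapsTo_X n _ hx)) (Φ.norm_fderiv_letter_le n _ hx)
    (norm_nonneg _) derivNorm_nonneg

/-- The two suprema on the left may be attained at unrelated points; distortion moves the first one
to the required point at the cost of K. -/
theorem DistortionBound.mul_le_wordNorm_succ {n : ℕ} (τ : Word I (n + 1)) :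
    Φ.wordNorm (Word.take n.le_succ τ) * derivNorm Φ.X (Φ.φ n (τ (Fin.last n))) ≤
      K * Φ.wordNorm τ := by
  have hpos := hK.wordNorm_pos (Word.take n.le_succ τ)
  rw [mul_comm, ← le_div_iff₀ hpos]
  refine derivNorm_le (fun x hx => ?_) Φ.nonempty_X
  rw [le_div_iff₀ hpos]
  have h1 := hK.wordNorm_le (Word.take n.le_succ τ) (Φ.mapsTo_X n (τ (Fin.last n)) hx)
  have h2 := hK.norm_fderiv_le τ hx
  rw [Φ.norm_fderiv_wordMap_succ τ (Φ.X_subset_V hx)] at h2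
  have hK0 : 0 ≤ K := zero_le_one.trans hK.1
  calc _ ≤ ‖fderiv ℝ (Φ.φ n (τ (Fin.last n))) x‖ * (K * _) :=
        mul_le_mul_of_nonneg_left h1 (norm_nonneg _)
    _ = K * (_ * ‖fderiv ℝ (Φ.φ n (τ (Fin.last n))) x‖) := by ring
    _ ≤ _ := mul_le_mul_of_nonneg_left h2 hK0

theorem DistortionBound.wordNorm_zero (τ : Word I 0) : Φ.wordNorm τ = 1 := by
  obtain ⟨x, hx⟩ := Φ.nonempty_X
  have h : ∀ y : EuclideanSpace ℝ (Fin d), ‖fderiv ℝ (Φ.wordMap 0 τ) y‖ = 1 := fun y => by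
    rw [wordMap_zero, fderiv_id, ContinuousLinearMap.norm_id]
  exact le_antisymm (derivNorm_le (fun y _ => (h y).le) Φ.nonempty_X)
    ((h x).symm.le.trans (hK.norm_fderiv_le τ hx))

/-- Word norms decay exponentially, uniformly in the word. -/
theorem DistortionBound.exists_wordNorm_le_exp :
    ∃ θ : ℝ, 0 < θ ∧ ∀ (n : ℕ) (τ : Word I n), Φ.wordNorm τ ≤ Real.exp (-θ) ^ n := by
  obtain ⟨θ, hθ, hc⟩ := Φ.contracting
  refine ⟨θ, hθ, fun n => ?_⟩
  induction n with
  | zero => intro τ; rw [hK.wordNorm_zero, pow_zero]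
  | succ n ih =>
    intro τ
    rw [pow_succ]
    exact (hK.wordNorm_succ_le τ).trans (mul_le_mul (ih _) (derivNorm_le (hc n _) Φ.nonempty_X)
      derivNorm_nonneg (by positivity))

theorem DistortionBound.eventually_wordNorm_le {s : ℝ} (hs : 0 < s) :
    ∀ᶠ n in atTop, ∀ τ : Word I n, Φ.wordNorm τ ≤ s := by
  obtain ⟨θ, hθ, hexp⟩ := hK.exists_wordNorm_le_exp
  have h := tendsto_pow_atTop_nhds_zero_of_lt_one (Real.exp_pos (-θ)).le
    (Real.exp_lt_one_iff.2 (neg_lt_zero.2 hθ))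
  filter_upwards [h.eventually (ge_mem_nhds hs)] with n hn τ using (hexp n τ).trans hn

omit [Nontrivial (EuclideanSpace ℝ (Fin d))] in
theorem DistortionBound.dist_le_of_mem_cylinder {n : ℕ} (τ : Word I n)
    {y z : EuclideanSpace ℝ (Fin d)} (hy : y ∈ Φ.cylinder n τ) (hz : z ∈ Φ.cylinder n τ) :
    dist y z ≤ Φ.wordNorm τ * Metric.diam Φ.X := by
  obtain ⟨y, hy, rfl⟩ := hy
  obtain ⟨z, hz, rfl⟩ := hz
  rw [dist_eq_norm]
  refine (Φ.convex_X.norm_image_sub_le_of_norm_fderiv_le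
    (fun x hx => (Φ.conformalAt_wordMap τ (Φ.X_subset_V hx)).differentiableAt)
    (fun x hx => hK.norm_fderiv_le τ hx) hz hy).trans ?_
  rw [← dist_eq_norm]
  exact mul_le_mul_of_nonneg_left (Metric.dist_le_diam_of_mem Φ.isCompact_X.isBounded hy hz)
    derivNorm_nonneg

omit [Nontrivial (EuclideanSpace ℝ (Fin d))] in
theorem DistortionBound.ball_subset_image_interior {x : EuclideanSpace ℝ (Fin d)} {R : ℝ}
    (hR : 0 < R) (hx : Metric.closedBall x R ⊆ interior Φ.X) {n : ℕ} (τ : Word I n) :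
    Metric.ball (Φ.wordMap n τ x) (Φ.wordNorm τ / K * R) ⊆ Φ.wordMap n τ '' interior Φ.X := by
  have hK0 : 0 < K := zero_lt_one.trans_le hK.1
  refine (ball_subset_image_ball_of_conformalAt hR
    (fun y hy => Φ.conformalAt_wordMap τ (Φ.X_subset_V (interior_subset (hx hy))))
    (fun y hy => ?_)).trans (image_mono (Metric.ball_subset_closedBall.trans hx))
  rw [div_le_iff₀ hK0, mul_comm]
  exact hK.wordNorm_le τ (interior_subset (hx hy))

theorem DistortionBound.isOpen_image_interior {n : ℕ} (τ : Word I n) :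
    IsOpen (Φ.wordMap n τ '' interior Φ.X) := by
  rw [Metric.isOpen_iff]
  rintro _ ⟨x, hx, rfl⟩
  obtain ⟨R, hR, hball⟩ := Metric.nhds_basis_closedBall.mem_iff.1 (isOpen_interior.mem_nhds hx)
  exact ⟨_, mul_pos (div_pos (hK.wordNorm_pos τ) (zero_lt_one.trans_le hK.1)) hR,
    hK.ball_subset_image_interior hR hball τ⟩

/-- Distortion is available for words only, and a letter of a later alphabet is not a word. So the
letter is put at the end of some word, whose image of int X is open, and the preceding continuous
injective map is undone by taking a preimage. -/
theorem DistortionBound.mapsTo_interior [∀ n, Nonempty (I n)] (hinj : Φ.IsInjective) (n : ℕ)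
    (a : I n) : MapsTo (Φ.φ n a) (interior Φ.X) (interior Φ.X) := by
  classical
  let τ : Word I (n + 1) := Function.update (fun k => Classical.arbitrary (I k)) (Fin.last n) a
  have hτ : τ (Fin.last n) = a := Function.update_self ..
  have hopen := hK.isOpen_image_interior τ
  rw [wordMap_succ, hτ, image_comp] at hopen
  set σ := Word.take n.le_succ τ
  have hpre : Φ.φ n a '' interior Φ.X =
      Φ.V ∩ Φ.wordMap n σ ⁻¹' (Φ.wordMap n σ '' (Φ.φ n a '' interior Φ.X)) := by
    rw [inter_comm, (hinj.injOn_wordMap σ).preimage_image_inter]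
    exact ((Φ.mapsTo_V n a).mono_left (interior_subset.trans Φ.X_subset_V)).image_subset
  have hopen' : IsOpen (Φ.φ n a '' interior Φ.X) := by
    rw [hpre]
    exact (Φ.continuousOn_wordMap σ).isOpen_inter_preimage Φ.isOpen_V hopen
  refine mapsTo_iff_image_subset.2 (interior_maximal ?_ hopen')
  exact ((Φ.mapsTo_X n a).mono_left interior_subset).image_subset

theorem DistortionBound.disjoint_image_interior [∀ n, Nonempty (I n)] (hinj : Φ.IsInjective)
    (hosc : Φ.OpenSetCondition) {n : ℕ} {σ τ : Word I n} (hne : σ ≠ τ) :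
    Disjoint (Φ.wordMap n σ '' interior Φ.X) (Φ.wordMap n τ '' interior Φ.X) := by
  induction n with
  | zero => exact absurd (Subsingleton.elim σ τ) hne
  | succ n ih =>
    by_cases htake : Word.take n.le_succ σ = Word.take n.le_succ τ
    · have hlast : σ (Fin.last n) ≠ τ (Fin.last n) := by
        intro hlast
        refine hne (funext fun k => ?_)
        induction k using Fin.lastCases with
        | last => exact hlast
        | cast k => exact congrFun htake k
      have hV : ∀ a : I n, Φ.φ n a '' interior Φ.X ⊆ Φ.V := fun a =>
        ((Φ.mapsTo_V n a).mono_left (interior_subset.trans Φ.X_subset_V)).image_subset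
      rw [wordMap_succ, wordMap_succ, htake, image_comp, image_comp]
      exact (disjoint_iff_inter_eq_empty.2 (hosc n _ _ hlast.symm)).image (hinj.injOn_wordMap _)
        (hV _) (hV _)
    · exact (ih htake).mono
        (Φ.image_wordMap_subset_take (hK.mapsTo_interior hinj) n.le_succ σ)
        (Φ.image_wordMap_subset_take (hK.mapsTo_interior hinj) n.le_succ τ)

theorem DistortionBound.disjoint_image_interior_of_take_ne [∀ n, Nonempty (I n)]
    (hinj : Φ.IsInjective) (hosc : Φ.OpenSetCondition) {k n : ℕ} (hkn : k ≤ n) {σ : Word I k}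
    {τ : Word I n} (hne : σ ≠ Word.take hkn τ) :
    Disjoint (Φ.wordMap k σ '' interior Φ.X) (Φ.wordMap n τ '' interior Φ.X) :=
  (hK.disjoint_image_interior hinj hosc hne).mono_right
    (Φ.image_wordMap_subset_take (hK.mapsTo_interior hinj) hkn τ)

/-- A convex body is the closure of its interior, so the cylinder of τ lies in the closure of the
image of int X, which an open set disjoint from that image cannot meet. -/
theorem DistortionBound.notMem_cylinder [∀ n, Nonempty (I n)] (hinj : Φ.IsInjective)
    (hosc : Φ.OpenSetCondition) {n : ℕ} {σ τ : Word I n} (hne : σ ≠ τ)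
    {x : EuclideanSpace ℝ (Fin d)} (hx : x ∈ interior Φ.X) :
    Φ.wordMap n σ x ∉ Φ.cylinder n τ := by
  have hdisj := hK.disjoint_image_interior hinj hosc hne
  have hcl : Φ.cylinder n τ ⊆ closure (Φ.wordMap n τ '' interior Φ.X) := by
    have hX : Φ.X = closure (interior Φ.X) := by
      rw [Φ.convex_X.closure_interior_eq_closure_of_nonempty_interior Φ.interior_X_nonempty,
        Φ.isCompact_X.isClosed.closure_eq]
    have hcont : ContinuousOn (Φ.wordMap n τ) (closure (interior Φ.X)) :=
      (Φ.continuousOn_wordMap τ).mono (hX ▸ Φ.X_subset_V)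
    have := hcont.image_closure
    rwa [← hX] at this
  exact fun hmem => (hdisj.closure_right (hK.isOpen_image_interior σ)).notMem_of_mem_left
    ⟨x, hx, rfl⟩ (hcl hmem)

end Distortion

end ConformalNIFS

/-! ### Transfer operators, weights of extensions, stopping along a word. -/

namespace ConformalNIFS

variable {d : ℕ} {I : ℕ → Type u} (Φ : ConformalNIFS d I)

theorem sum_word_succ [∀ n, Fintype (I n)] {n : ℕ} (g : Word I n → I n → ℝ) :
    ∑ τ : Word I (n + 1), g (Word.take n.le_succ τ) (τ (Fin.last n)) =
      ∑ a : I n, ∑ ω : Word I n, g ω a := by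
  rw [← Fintype.sum_prod_type']
  exact Fintype.sum_equiv (Fin.snocEquiv fun k : Fin (n + 1) => I k).symm _ _ fun τ => rfl

variable [Nontrivial (EuclideanSpace ℝ (Fin d))] [∀ n, Fintype (I n)]

/-- The chain rule is an equality of norms for conformal maps. The new letter is innermost, so it
only moves the base point and contributes a nonnegative factor. -/
theorem sum_take_mul_rpow_succ (h : ℝ) {n : ℕ} (g : Word I n → ℝ) {x : EuclideanSpace ℝ (Fin d)}
    (hx : x ∈ Φ.X) :
    ∑ τ : Word I (n + 1), g (Word.take n.le_succ τ) * ‖fderiv ℝ (Φ.wordMap (n + 1) τ) x‖ ^ h =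
      ∑ a : I n, ‖fderiv ℝ (Φ.φ n a) x‖ ^ h *
        ∑ ω : Word I n, g ω * ‖fderiv ℝ (Φ.wordMap n ω) (Φ.φ n a x)‖ ^ h := by
  simp_rw [Finset.mul_sum]
  rw [← sum_word_succ (fun ω a => ‖fderiv ℝ (Φ.φ n a) x‖ ^ h *
    (g ω * ‖fderiv ℝ (Φ.wordMap n ω) (Φ.φ n a x)‖ ^ h))]
  refine Finset.sum_congr rfl fun τ _ => ?_
  rw [Φ.norm_fderiv_wordMap_succ τ (Φ.X_subset_V hx),
    Real.mul_rpow (norm_nonneg _) (norm_nonneg _)]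
  ring

/-- Positivity of the transfer operators: an inequality between weighted sums over words of
length `k` is inherited by the extensions of these words. -/
theorem sum_take_mul_rpow_nonneg (h : ℝ) {k n : ℕ} (hkn : k ≤ n) (g : Word I k → ℝ)
    (hg : ∀ x ∈ Φ.X, 0 ≤ ∑ ω : Word I k, g ω * ‖fderiv ℝ (Φ.wordMap k ω) x‖ ^ h)
    {x : EuclideanSpace ℝ (Fin d)} (hx : x ∈ Φ.X) :
    0 ≤ ∑ τ : Word I n, g (Word.take hkn τ) * ‖fderiv ℝ (Φ.wordMap n τ) x‖ ^ h := by
  induction n, hkn using Nat.le_induction generalizing x with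
  | base => exact hg x hx
  | succ n hkn ih =>
    have := Φ.sum_take_mul_rpow_succ h (fun ω => g (Word.take hkn ω)) hx
    simp only [Word.take_take] at this
    rw [this]
    exact Finset.sum_nonneg fun a _ => mul_nonneg (Real.rpow_nonneg (norm_nonneg _) _)
      (ih (Φ.mapsTo_X n a hx))

section Distortion

variable {Φ} {K : ℝ} (hK : Φ.DistortionBound K) {h : ℝ} (hh : 0 ≤ h)
include hK

theorem DistortionBound.Z_pos [∀ n, Nonempty (I n)] (n : ℕ) (h : ℝ) : 0 < Φ.Z n h :=
  Finset.sum_pos (fun ω _ => Real.rpow_pos_of_pos (hK.wordNorm_pos ω) h) Finset.univ_nonempty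

include hh

variable [∀ n, Nonempty (I n)]

open Classical in
/-- The weight of the extensions of a word, from above. -/
theorem DistortionBound.sum_extensions_le {k n : ℕ} (hkn : k ≤ n) (σ : Word I k) :
    ∑ τ : Word I n with Word.take hkn τ = σ, Φ.wordNorm τ ^ h / Φ.Z n h ≤
      (K ^ h) ^ 2 * (Φ.wordNorm σ ^ h / Φ.Z k h) := by
  obtain ⟨x, hx⟩ := Φ.nonempty_X
  have hKh : 0 < K ^ h := Real.rpow_pos_of_pos (zero_lt_one.trans_le hK.1) h
  have hZk := hK.Z_pos k h
  have hZn := hK.Z_pos n h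
  have hσ : 0 ≤ Φ.wordNorm σ ^ h := Real.rpow_nonneg derivNorm_nonneg h
  -- Positivity is applied to c minus the indicator of σ. One factor K^h, in c, passes from Z_k to
  -- pointwise derivatives; the other is spent at level n, so no loss accumulates in between.
  set c := K ^ h * (Φ.wordNorm σ ^ h / Φ.Z k h) with hc
  have hc0 : 0 ≤ c := by positivity
  have key := Φ.sum_take_mul_rpow_nonneg h hkn (fun ω => c - if ω = σ then 1 else 0) (by
    intro y hy
    simp only [sub_mul, ite_mul, one_mul, zero_mul, Finset.sum_sub_distrib, Finset.sum_ite_eq',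
      Finset.mem_univ, if_true, ← Finset.mul_sum, sub_nonneg]
    have h1 : Φ.Z k h ≤ K ^ h * ∑ ω : Word I k, ‖fderiv ℝ (Φ.wordMap k ω) y‖ ^ h := by
      rw [Finset.mul_sum]
      exact Finset.sum_le_sum fun ω _ => hK.rpow_wordNorm_le hh ω hy
    calc _ ≤ Φ.wordNorm σ ^ h := hK.rpow_norm_fderiv_le hh σ hy
      _ = Φ.wordNorm σ ^ h / Φ.Z k h * Φ.Z k h := by field_simp
      _ ≤ Φ.wordNorm σ ^ h / Φ.Z k h * _ := mul_le_mul_of_nonneg_left h1 (by positivity)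
      _ = _ := by rw [hc]; ring) hx
  simp only [sub_mul, ite_mul, one_mul, zero_mul, Finset.sum_sub_distrib, ← Finset.mul_sum,
    sub_nonneg, ← Finset.sum_filter] at key
  have h2 : ∑ τ : Word I n, ‖fderiv ℝ (Φ.wordMap n τ) x‖ ^ h ≤ Φ.Z n h :=
    Finset.sum_le_sum fun ω _ => hK.rpow_norm_fderiv_le hh ω hx
  rw [← Finset.sum_div, div_le_iff₀ hZn]
  calc _ ≤ ∑ τ : Word I n with Word.take hkn τ = σ, K ^ h * ‖fderiv ℝ (Φ.wordMap n τ) x‖ ^ h :=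
        Finset.sum_le_sum fun τ _ => hK.rpow_wordNorm_le hh τ hx
    _ ≤ K ^ h * (c * Φ.Z n h) := by
        rw [← Finset.mul_sum]
        exact mul_le_mul_of_nonneg_left (key.trans (mul_le_mul_of_nonneg_left h2 hc0)) hKh.le
    _ = _ := by rw [hc]; ring

open Classical in
/-- The weight of the extensions of a word, from below. -/
theorem DistortionBound.le_sum_extensions {k n : ℕ} (hkn : k ≤ n) (σ : Word I k) :
    ((K ^ h) ^ 2)⁻¹ * (Φ.wordNorm σ ^ h / Φ.Z k h) ≤
      ∑ τ : Word I n with Word.take hkn τ = σ, Φ.wordNorm τ ^ h / Φ.Z n h := by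
  obtain ⟨x, hx⟩ := Φ.nonempty_X
  have hKh : 0 < K ^ h := Real.rpow_pos_of_pos (zero_lt_one.trans_le hK.1) h
  have hZk := hK.Z_pos k h
  have hZn := hK.Z_pos n h
  have hσ : 0 ≤ Φ.wordNorm σ ^ h := Real.rpow_nonneg derivNorm_nonneg h
  -- The mirror image: now the indicator of σ minus c is the test weight.
  set c := (K ^ h)⁻¹ * (Φ.wordNorm σ ^ h / Φ.Z k h) with hc
  have hc0 : 0 ≤ c := by positivity
  have key := Φ.sum_take_mul_rpow_nonneg h hkn (fun ω => (if ω = σ then 1 else 0) - c) (by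
    intro y hy
    simp only [sub_mul, ite_mul, one_mul, zero_mul, Finset.sum_sub_distrib, Finset.sum_ite_eq',
      Finset.mem_univ, if_true, ← Finset.mul_sum, sub_nonneg]
    have h1 : ∑ ω : Word I k, ‖fderiv ℝ (Φ.wordMap k ω) y‖ ^ h ≤ Φ.Z k h :=
      Finset.sum_le_sum fun ω _ => hK.rpow_norm_fderiv_le hh ω hy
    calc _ ≤ c * Φ.Z k h := mul_le_mul_of_nonneg_left h1 hc0
      _ = (K ^ h)⁻¹ * Φ.wordNorm σ ^ h := by rw [hc]; field_simp
      _ ≤ _ := by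
        rw [inv_mul_le_iff₀ hKh]
        exact hK.rpow_wordNorm_le hh σ hy) hx
  simp only [sub_mul, ite_mul, one_mul, zero_mul, Finset.sum_sub_distrib, ← Finset.mul_sum,
    sub_nonneg, ← Finset.sum_filter] at key
  have h2 : Φ.Z n h ≤ K ^ h * ∑ τ : Word I n, ‖fderiv ℝ (Φ.wordMap n τ) x‖ ^ h := by
    rw [Finset.mul_sum]
    exact Finset.sum_le_sum fun ω _ => hK.rpow_wordNorm_le hh ω hx
  rw [← Finset.sum_div, le_div_iff₀ hZn]
  calc _ = c * ((K ^ h)⁻¹ * Φ.Z n h) := by rw [hc]; field_simp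
    _ ≤ c * ∑ τ : Word I n, ‖fderiv ℝ (Φ.wordMap n τ) x‖ ^ h := by
        refine mul_le_mul_of_nonneg_left ?_ hc0
        rwa [inv_mul_le_iff₀ hKh]
    _ ≤ _ := key.trans (Finset.sum_le_sum fun τ _ => hK.rpow_norm_fderiv_le hh τ hx)

omit [∀ n, Nonempty (I n)] in
theorem DistortionBound.Z_succ_le {n : ℕ} {B : ℝ}
    (hB : ∀ a, derivNorm Φ.X (Φ.φ n a) ^ h ≤ B) :
    Φ.Z (n + 1) h ≤ Φ.Z n h * (Fintype.card (I n) * B) := by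
  calc Φ.Z (n + 1) h ≤ ∑ τ : Word I (n + 1), Φ.wordNorm (Word.take n.le_succ τ) ^ h * B := by
        refine Finset.sum_le_sum fun τ _ => ?_
        refine (Real.rpow_le_rpow derivNorm_nonneg (hK.wordNorm_succ_le τ) hh).trans ?_
        rw [Real.mul_rpow (Φ.wordNorm_nonneg _) derivNorm_nonneg]
        exact mul_le_mul_of_nonneg_left (hB _) (Real.rpow_nonneg derivNorm_nonneg _)
    _ = ∑ _a : I n, ∑ ω : Word I n, Φ.wordNorm ω ^ h * B :=
        sum_word_succ fun ω _ => Φ.wordNorm ω ^ h * B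
    _ = _ := by
        rw [Finset.sum_const, Finset.card_univ, nsmul_eq_mul, ← Finset.sum_mul]
        simp only [Z, wordNorm]
        ring

/-- If one letter had a tiny norm, bounded ratios would make its whole alphabet tiny; the alphabet
being of bounded size, the partition function would drop too far in a single step. -/
theorem DistortionBound.exists_le_rpow_letterNorm
    (hcard : BddAbove (Set.range fun n => Fintype.card (I n)))
    (hρ : BddAbove (Set.range fun n => Φ.ρ n))
    (hZ : BddAbove (Set.range fun n => Φ.Z n h))
    (hZinv : BddAbove (Set.range fun n => (Φ.Z n h)⁻¹)) :
    ∃ c : ℝ, 0 < c ∧ ∀ n a, c ≤ derivNorm Φ.X (Φ.φ n a) ^ h := by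
  obtain ⟨N, hN⟩ := hcard
  obtain ⟨R, hR⟩ := hρ
  obtain ⟨M, hM⟩ := hZ
  obtain ⟨M', hM'⟩ := hZinv
  have hN' : ∀ n, Fintype.card (I n) ≤ N := fun n => hN ⟨n, rfl⟩
  have hR' : ∀ n, Φ.ρ n ≤ R := fun n => hR ⟨n, rfl⟩
  have hM1 : ∀ n, Φ.Z n h ≤ M := fun n => hM ⟨n, rfl⟩
  have hM1' : ∀ n, (Φ.Z n h)⁻¹ ≤ M' := fun n => hM' ⟨n, rfl⟩
  have hratio : ∀ n (a b : I n),
      derivNorm Φ.X (Φ.φ n a) ≤ R * derivNorm Φ.X (Φ.φ n b) := fun n a b => by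
    rw [← div_le_iff₀ (Φ.letterNorm_pos n b)]
    exact (le_ciSup (f := fun p : I n × I n => derivNorm Φ.X (Φ.φ n p.1) /
      derivNorm Φ.X (Φ.φ n p.2)) (Set.finite_range _).bddAbove (a, b)).trans (hR' n)
  have hR0 : 0 < R := by
    let b : I 0 := Classical.arbitrary _
    exact pos_of_mul_pos_left ((Φ.letterNorm_pos 0 b).trans_le (hratio 0 b b)) derivNorm_nonneg
  have hM0 : 0 < M := (hK.Z_pos 0 h).trans_le (hM1 0)
  have hM0' : 0 < M' := (inv_pos.2 (hK.Z_pos 0 h)).trans_le (hM1' 0)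
  have hN0 : (0 : ℝ) < N := Nat.cast_pos.2 (Fintype.card_pos.trans_le (hN' 0))
  have hRh : 0 < R ^ h := Real.rpow_pos_of_pos hR0 h
  refine ⟨(M' * M * N * R ^ h)⁻¹, by positivity, fun n b => ?_⟩
  set q := derivNorm Φ.X (Φ.φ n b) ^ h with hq
  have hq0 : 0 ≤ q := Real.rpow_nonneg derivNorm_nonneg h
  have h1 := hK.Z_succ_le hh (n := n) (B := R ^ h * q) fun a => by
    rw [hq, ← Real.mul_rpow hR0.le derivNorm_nonneg]
    exact Real.rpow_le_rpow derivNorm_nonneg (hratio n a b) hh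
  have h2 : M'⁻¹ ≤ Φ.Z (n + 1) h := by
    rw [inv_le_comm₀ hM0' (hK.Z_pos _ h)]
    exact hM1' _
  have h3 : M'⁻¹ ≤ M * (N * (R ^ h * q)) := by
    refine h2.trans (h1.trans (mul_le_mul (hM1 n) ?_ (by positivity) hM0.le))
    exact mul_le_mul_of_nonneg_right (Nat.cast_le.2 (hN' n)) (by positivity)
  rw [inv_le_iff_one_le_mul₀ (by positivity)] at h3 ⊢
  linarith

omit [∀ n, Nonempty (I n)] [∀ n, Fintype (I n)] in
/-- Along every word of small norm there is a first initial subword whose norm is below a given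
threshold, and it is not far below. -/
theorem DistortionBound.exists_take_stopping {c : ℝ} (hc : 0 < c)
    (hcl : ∀ n a, c ≤ derivNorm Φ.X (Φ.φ n a) ^ h) {n : ℕ} (τ : Word I n) {s : ℝ} (hs : 0 < s)
    (hs1 : s ≤ 1) (hτ : Φ.wordNorm τ ≤ s) :
    ∃ (k : ℕ) (hkn : k ≤ n), Φ.wordNorm (Word.take hkn τ) ≤ s ∧
      (∀ (j : ℕ) (hj : j < k), s < Φ.wordNorm (Word.take hj.le (Word.take hkn τ))) ∧
      min 1 (c / K ^ h) * s ^ h ≤ Φ.wordNorm (Word.take hkn τ) ^ h := by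
  classical
  have hex : ∃ k, ∃ hkn : k ≤ n, Φ.wordNorm (Word.take hkn τ) ≤ s := ⟨n, le_rfl, hτ⟩
  obtain ⟨hkn, hks⟩ := Nat.find_spec hex
  have hmin : ∀ (j : ℕ) (hj : j < Nat.find hex),
      s < Φ.wordNorm (Word.take hj.le (Word.take hkn τ)) := fun j hj => by
    have := Nat.find_min hex hj
    push Not at this
    exact this (hj.le.trans hkn)
  refine ⟨Nat.find hex, hkn, hks, hmin, ?_⟩
  have hsh : 0 ≤ s ^ h := Real.rpow_nonneg hs.le h
  generalize hk : Nat.find hex = k at hkn hks hmin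
  -- The empty word has norm 1, and s ≤ 1; this case accounts for the 1 in the minimum.
  rcases k with - | k
  · rw [hK.wordNorm_zero, Real.one_rpow]
    exact mul_le_one₀ (min_le_left _ _) hsh (Real.rpow_le_one hs.le hs1 hh)
  · have hKh : 0 < K ^ h := Real.rpow_pos_of_pos (zero_lt_one.trans_le hK.1) h
    set σ := Word.take hkn τ
    have h1 := Real.rpow_le_rpow (mul_nonneg (Φ.wordNorm_nonneg _) derivNorm_nonneg)
      (hK.mul_le_wordNorm_succ σ) hh
    rw [Real.mul_rpow (Φ.wordNorm_nonneg _) derivNorm_nonneg,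
      Real.mul_rpow (zero_le_one.trans hK.1) (Φ.wordNorm_nonneg _)] at h1
    have h2 : s ^ h ≤ Φ.wordNorm (Word.take k.le_succ σ) ^ h :=
      Real.rpow_le_rpow hs.le (hmin k k.lt_succ_self).le hh
    refine (mul_le_mul_of_nonneg_right (min_le_right _ _) hsh).trans ?_
    rw [div_mul_eq_mul_div, div_le_iff₀ hKh, mul_comm _ (K ^ h), mul_comm c]
    exact (mul_le_mul h2 (hcl _ _) hc.le (hsh.trans h2)).trans h1

end Distortion

end ConformalNIFS

theorem Finset.sum_biUnion_le_of_nonneg {ι α : Type*} [DecidableEq α] (s : Finset ι)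
    (t : ι → Finset α) {f : α → ℝ} (hf : ∀ a, 0 ≤ f a) :
    ∑ a ∈ s.biUnion t, f a ≤ ∑ i ∈ s, ∑ a ∈ t i, f a := by
  classical
  induction s using Finset.induction_on with
  | empty => simp
  | insert i s hi ih =>
    rw [Finset.biUnion_insert, Finset.sum_insert hi]
    have h1 := Finset.sum_union_inter (s₁ := t i) (s₂ := s.biUnion t) (f := f)
    have h2 : 0 ≤ ∑ a ∈ t i ∩ s.biUnion t, f a := Finset.sum_nonneg fun a _ => hf a
    linarith

/-! ### Cylinder measures and the mass of balls. -/

namespace ConformalNIFS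

variable {d : ℕ} {I : ℕ → Type u} {Φ : ConformalNIFS d I} [∀ n, Fintype (I n)] {h : ℝ} {n : ℕ}

theorem weight_nonneg (ω : Word I n) : 0 ≤ Φ.wordNorm ω ^ h / Φ.Z n h :=
  div_nonneg (Real.rpow_nonneg (Φ.wordNorm_nonneg ω) h)
    (Finset.sum_nonneg fun ω _ => Real.rpow_nonneg (Φ.wordNorm_nonneg ω) h)

section CylinderMeasure

variable {ν : Measure (EuclideanSpace ℝ (Fin d))} (hν : Φ.IsCylinderMeasure h n ν)
include hν

theorem IsCylinderMeasure.measure_biUnion_le (T : Finset (Word I n)) :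
    ν (⋃ τ ∈ T, Φ.cylinder n τ) ≤ ENNReal.ofReal (∑ τ ∈ T, Φ.wordNorm τ ^ h / Φ.Z n h) := by
  rw [ENNReal.ofReal_sum_of_nonneg fun τ _ => weight_nonneg τ]
  exact (measure_biUnion_finset_le T _).trans (Finset.sum_le_sum fun τ _ => (hν.2 τ).le)

open Classical in
theorem IsCylinderMeasure.measure_le (S : Set (EuclideanSpace ℝ (Fin d))) :
    ν S ≤ ENNReal.ofReal (∑ τ : Word I n with (Φ.cylinder n τ ∩ S).Nonempty,
      Φ.wordNorm τ ^ h / Φ.Z n h) := by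
  refine le_trans ?_ (hν.measure_biUnion_le _)
  rw [← zero_add (ν (⋃ τ ∈ _, _)), ← hν.1]
  refine le_trans (measure_mono fun y hy => ?_) (measure_union_le _ _)
  by_cases hyl : y ∈ ⋃ ω : Word I n, Φ.cylinder n ω
  · obtain ⟨τ, hτ⟩ := mem_iUnion.1 hyl
    exact Or.inr (mem_iUnion₂.2 ⟨τ, Finset.mem_filter.2 ⟨Finset.mem_univ _, y, hτ, hy⟩, hτ⟩)
  · exact Or.inl hyl

variable [Nontrivial (EuclideanSpace ℝ (Fin d))] [∀ n, Nonempty (I n)] {K : ℝ}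
  (hK : Φ.DistortionBound K)
include hK

omit hν in
theorem DistortionBound.sum_weight_eq_one (n : ℕ) :
    ∑ τ : Word I n, Φ.wordNorm τ ^ h / Φ.Z n h = 1 := by
  rw [← Finset.sum_div]
  exact div_self (hK.Z_pos n h).ne'

/-- Cylinders may overlap along boundaries, so their masses cannot simply be added. The weights sum
to 1, however, and the cylinders outside T cover at most their own share. -/
theorem IsCylinderMeasure.le_measure_biUnion [IsProbabilityMeasure ν] (T : Finset (Word I n)) :
    ENNReal.ofReal (∑ τ ∈ T, Φ.wordNorm τ ^ h / Φ.Z n h) ≤ ν (⋃ τ ∈ T, Φ.cylinder n τ) := by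
  classical
  have h1 : ENNReal.ofReal (∑ τ ∈ T, Φ.wordNorm τ ^ h / Φ.Z n h) +
      ENNReal.ofReal (∑ τ ∈ Tᶜ, Φ.wordNorm τ ^ h / Φ.Z n h) = 1 := by
    rw [← ENNReal.ofReal_add (Finset.sum_nonneg fun τ _ => weight_nonneg τ)
      (Finset.sum_nonneg fun τ _ => weight_nonneg τ), Finset.sum_add_sum_compl,
      hK.sum_weight_eq_one, ENNReal.ofReal_one]
  refine ENNReal.le_of_add_le_add_right (ENNReal.ofReal_ne_top
    (r := ∑ τ ∈ Tᶜ, Φ.wordNorm τ ^ h / Φ.Z n h)) ?_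
  rw [h1, ← measure_univ (μ := ν)]
  refine le_trans ?_ (add_le_add_right (hν.measure_biUnion_le Tᶜ) _)
  refine le_trans ?_ (measure_union_le _ _)
  rw [← zero_add (ν (_ ∪ _)), ← hν.1]
  refine le_trans (measure_mono fun y _ => ?_) (measure_union_le _ _)
  by_cases hyl : y ∈ ⋃ ω : Word I n, Φ.cylinder n ω
  · obtain ⟨τ, hτ⟩ := mem_iUnion.1 hyl
    refine Or.inr ?_
    by_cases hT : τ ∈ T
    · exact Or.inl (mem_iUnion₂.2 ⟨τ, hT, hτ⟩)
    · exact Or.inr (mem_iUnion₂.2 ⟨τ, Finset.mem_compl.2 hT, hτ⟩)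
  · exact Or.inl hyl

open Classical in
theorem IsCylinderMeasure.le_measure_cylinder [IsProbabilityMeasure ν] (hh : 0 ≤ h) {k : ℕ}
    (hkn : k ≤ n) (σ : Word I k) :
    ENNReal.ofReal (((K ^ h) ^ 2)⁻¹ * (Φ.wordNorm σ ^ h / Φ.Z k h)) ≤ ν (Φ.cylinder k σ) := by
  refine (ENNReal.ofReal_le_ofReal (hK.le_sum_extensions hh hkn σ)).trans
    ((hν.le_measure_biUnion hK _).trans (measure_mono (iUnion₂_subset fun τ hτ => ?_)))
  rw [← (Finset.mem_filter.1 hτ).2]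
  exact Φ.cylinder_subset_take hkn τ

end CylinderMeasure

section Stopping

variable (Φ) in
/-- A word is stopping for `s` if it is the first of its initial subwords with norm at most `s`. -/
def IsStopping (s : ℝ) {k : ℕ} (σ : Word I k) : Prop :=
  Φ.wordNorm σ ≤ s ∧ ∀ (j : ℕ) (hj : j < k), s < Φ.wordNorm (Word.take hj.le σ)

variable [Nontrivial (EuclideanSpace ℝ (Fin d))] [∀ n, Nonempty (I n)] {K : ℝ}
  (hK : Φ.DistortionBound K) (hinj : Φ.IsInjective) (hosc : Φ.OpenSetCondition)
include hK hinj hosc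

omit [∀ n, Fintype (I n)] in
-- No stopping word properly extends another, since its proper initial subwords have norm above s.
theorem DistortionBound.disjoint_of_isStopping {s : ℝ} {n : ℕ} {p q : Σ k : Fin (n + 1), Word I k}
    (hp : Φ.IsStopping s p.2) (hq : Φ.IsStopping s q.2) (hpq : p ≠ q) :
    Disjoint (Φ.wordMap p.1 p.2 '' interior Φ.X) (Φ.wordMap q.1 q.2 '' interior Φ.X) := by
  wlog hle : p.1 ≤ q.1 generalizing p q
  · exact (this hq hp hpq.symm (le_of_not_ge hle)).symm
  by_cases htake : p.2 = Word.take (k := (p.1 : ℕ)) (n := (q.1 : ℕ)) hle q.2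
  · exfalso
    rcases hle.lt_or_eq with hlt | heq
    · exact absurd hp.1 (htake ▸ (hq.2 p.1 hlt).not_ge)
    · obtain ⟨k, σ⟩ := p
      obtain ⟨l, τ⟩ := q
      obtain rfl : k = l := heq
      exact hpq (Sigma.ext rfl (heq_of_eq htake))
  · exact hK.disjoint_image_interior_of_take_ne hinj hosc hle htake

omit [∀ n, Fintype (I n)] in
/-- A ball of radius `s` meets a bounded number of cylinders of stopping words of comparable
norm. -/
theorem DistortionBound.exists_card_stopping_le {c : ℝ} (hc : 0 < c) :
    ∃ M : ℝ, 0 < M ∧ ∀ (x : EuclideanSpace ℝ (Fin d)) (s : ℝ), 0 < s → ∀ (n : ℕ)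
      (S : Finset (Σ k : Fin (n + 1), Word I k)),
      (∀ p ∈ S, Φ.IsStopping s p.2 ∧ c * s ≤ Φ.wordNorm p.2 ∧
        (Φ.cylinder p.1 p.2 ∩ Metric.ball x s).Nonempty) → (S.card : ℝ) ≤ M := by
  obtain ⟨x₀, hx₀⟩ := Φ.interior_X_nonempty
  obtain ⟨R, hR, hball⟩ := Metric.nhds_basis_closedBall.mem_iff.1 (isOpen_interior.mem_nhds hx₀)
  have hK0 : 0 < K := zero_lt_one.trans_le hK.1
  have hD : 0 < Metric.diam Φ.X + 1 := add_pos_of_nonneg_of_pos Metric.diam_nonneg one_pos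
  -- Ratio of the outer radius s (diam X + 1) to the radius c s R / K of the inscribed balls.
  refine ⟨((Metric.diam Φ.X + 1) / (c / K * R)) ^
    Module.finrank ℝ (EuclideanSpace ℝ (Fin d)), by positivity, fun x s hs n S hS => ?_⟩
  refine card_le_pow_of_disjoint_balls S (fun p => Φ.wordMap p.1 p.2 '' interior Φ.X)
    (fun p => Φ.wordMap p.1 p.2 x₀) x (a := c * s / K * R) (by positivity) (by positivity)
    (fun p hp => ?_) (fun p hp => ?_) (fun p hp q hq hpq => ?_)
  · refine (Metric.ball_subset_ball ?_).trans (hK.ball_subset_image_interior hR hball p.2)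
    have := (hS p hp).2.1
    gcongr
  · obtain ⟨⟨hps, -⟩, -, y, hy, hyx⟩ := hS p hp
    have hrad : (Metric.diam Φ.X + 1) / (c / K * R) * (c * s / K * R) =
        s * Metric.diam Φ.X + s := by
      field_simp
    rw [hrad]
    intro z hz
    have hz' : z ∈ Φ.cylinder p.1 p.2 := image_mono interior_subset hz
    have h1 := hK.dist_le_of_mem_cylinder p.2 hz' hy
    have h2 := mul_le_mul_of_nonneg_right hps (Metric.diam_nonneg (s := Φ.X))
    rw [Metric.mem_ball] at hyx ⊢
    linarith [dist_triangle z y x]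
  · exact hK.disjoint_of_isStopping hinj hosc (hS p hp).1 (hS q hq).1 hpq

/-- Upper bound for the mass that cylinder measures of high level give to a ball. -/
theorem DistortionBound.exists_measure_ball_le (hh : 0 ≤ h) {c : ℝ} (hc : 0 < c)
    (hcl : ∀ n a, c ≤ derivNorm Φ.X (Φ.φ n a) ^ h)
    (hZinv : BddAbove (Set.range fun n => (Φ.Z n h)⁻¹)) :
    ∃ C : ℝ, 1 ≤ C ∧ ∀ (x : EuclideanSpace ℝ (Fin d)) (r : ℝ), 0 < r → r ≤ 1 →
      ∀ᶠ n in atTop, ∀ ν : Measure (EuclideanSpace ℝ (Fin d)), Φ.IsCylinderMeasure h n ν →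
        ν (Metric.ball x r) ≤ ENNReal.ofReal (C * r ^ h) := by
  classical
  -- For h = 0 the lower bound on h-th powers says nothing about norms, but total mass 1 is bound
  -- enough.
  rcases hh.eq_or_lt with rfl | hpos
  · refine ⟨1, le_rfl, fun x r _ _ => Eventually.of_forall fun n ν hν => ?_⟩
    refine (hν.measure_le _).trans (ENNReal.ofReal_le_ofReal ?_)
    rw [Real.rpow_zero, mul_one, ← hK.sum_weight_eq_one (h := 0) n]
    exact Finset.sum_le_sum_of_subset_of_nonneg (Finset.subset_univ _)
      fun τ _ _ => weight_nonneg τ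
  have hKh : 0 < K ^ h := Real.rpow_pos_of_pos (zero_lt_one.trans_le hK.1) h
  obtain ⟨M', hM'⟩ := hZinv
  have hM1' : ∀ n, (Φ.Z n h)⁻¹ ≤ M' := fun n => hM' ⟨n, rfl⟩
  have hM0' : 0 < M' := (inv_pos.2 (hK.Z_pos 0 h)).trans_le (hM1' 0)
  set c₁ := min 1 (c / K ^ h) with hc₁
  have hc₁0 : 0 < c₁ := lt_min one_pos (by positivity)
  obtain ⟨M, hM, hcard⟩ := hK.exists_card_stopping_le hinj hosc
    (Real.rpow_pos_of_pos hc₁0 h⁻¹)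
  refine ⟨max 1 (M * ((K ^ h) ^ 2 * M')), le_max_left _ _, fun x r hr hr1 => ?_⟩
  have hrh : 0 < r ^ h := Real.rpow_pos_of_pos hr h
  filter_upwards [hK.eventually_wordNorm_le hr] with n hn ν hν
  refine (hν.measure_le _).trans (ENNReal.ofReal_le_ofReal ?_)
  let S : Finset (Σ k : Fin (n + 1), Word I k) :=
    {p | Φ.IsStopping r p.2 ∧ c₁ ^ h⁻¹ * r ≤ Φ.wordNorm p.2 ∧
        (Φ.cylinder p.1 p.2 ∩ Metric.ball x r).Nonempty}
  have hS : ∀ p, p ∈ S ↔ Φ.IsStopping r p.2 ∧ c₁ ^ h⁻¹ * r ≤ Φ.wordNorm p.2 ∧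
      (Φ.cylinder p.1 p.2 ∩ Metric.ball x r).Nonempty := fun p => by simp [S]
  have hScard : (S.card : ℝ) ≤ M := hcard x r hr n S fun p hp => (hS p).1 hp
  calc ∑ τ : Word I n with (Φ.cylinder n τ ∩ Metric.ball x r).Nonempty,
        Φ.wordNorm τ ^ h / Φ.Z n h
      ≤ ∑ τ ∈ S.biUnion fun p => {τ : Word I n | Word.take p.1.is_le τ = p.2},
          Φ.wordNorm τ ^ h / Φ.Z n h := by
        refine Finset.sum_le_sum_of_subset_of_nonneg (fun τ hτ => ?_)
          fun τ _ _ => weight_nonneg τ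
        obtain ⟨k, hkn, h1, h2, h3⟩ := hK.exists_take_stopping hh hc hcl τ hr hr1 (hn τ)
        refine Finset.mem_biUnion.2 ⟨⟨⟨k, Nat.lt_succ_of_le hkn⟩, Word.take hkn τ⟩, ?_, ?_⟩
        · refine (hS _).2 ⟨⟨h1, h2⟩, ?_, ?_⟩
          · rw [← Real.rpow_le_rpow_iff (by positivity) (Φ.wordNorm_nonneg _) hpos,
              Real.mul_rpow (by positivity) hr.le, Real.rpow_inv_rpow hc₁0.le hpos.ne']
            exact h3
          · exact (Finset.mem_filter.1 hτ).2.mono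
              (inter_subset_inter_left _ (Φ.cylinder_subset_take hkn τ))
        · exact Finset.mem_filter.2 ⟨Finset.mem_univ _, rfl⟩
    _ ≤ ∑ p ∈ S, ∑ τ : Word I n with Word.take p.1.is_le τ = p.2,
          Φ.wordNorm τ ^ h / Φ.Z n h :=
        Finset.sum_biUnion_le_of_nonneg S _ fun τ => weight_nonneg τ
    _ ≤ ∑ p ∈ S, (K ^ h) ^ 2 * M' * r ^ h := by
        refine Finset.sum_le_sum fun p hp => (hK.sum_extensions_le hh p.1.is_le p.2).trans ?_
        rw [mul_assoc, div_eq_inv_mul]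
        have := Real.rpow_le_rpow (Φ.wordNorm_nonneg _) ((hS p).1 hp).1.1 hh
        have := Real.rpow_nonneg (Φ.wordNorm_nonneg p.2) h
        have := hM1' p.1
        gcongr
    _ = S.card * ((K ^ h) ^ 2 * M') * r ^ h := by
        rw [Finset.sum_const, nsmul_eq_mul]
        ring
    _ ≤ _ := by
        refine mul_le_mul_of_nonneg_right (le_trans ?_ (le_max_right _ _)) hrh.le
        exact mul_le_mul_of_nonneg_right hScard (by positivity)

omit hinj hosc in
/-- Lower bound for the mass that cylinder measures of high level give to a ball centred on the
limit set. -/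
theorem DistortionBound.exists_le_measure_closedBall (hh : 0 ≤ h) {c : ℝ} (hc : 0 < c)
    (hcl : ∀ n a, c ≤ derivNorm Φ.X (Φ.φ n a) ^ h)
    (hZ : BddAbove (Set.range fun n => Φ.Z n h)) :
    ∃ b : ℝ, 0 < b ∧ ∀ x ∈ Φ.limitSet, ∀ r : ℝ, 0 < r → r ≤ 1 →
      ∀ᶠ n in atTop, ∀ ν : Measure (EuclideanSpace ℝ (Fin d)), IsProbabilityMeasure ν →
        Φ.IsCylinderMeasure h n ν →
        ENNReal.ofReal (b * r ^ h) ≤ ν (Metric.closedBall x (r / 2)) := by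
  have hKh : 0 < K ^ h := Real.rpow_pos_of_pos (zero_lt_one.trans_le hK.1) h
  obtain ⟨M, hM⟩ := hZ
  have hM1 : ∀ n, Φ.Z n h ≤ M := fun n => hM ⟨n, rfl⟩
  have hM0 : 0 < M := (hK.Z_pos 0 h).trans_le (hM1 0)
  set c₁ := min 1 (c / K ^ h) with hc₁
  have hc₁0 : 0 < c₁ := lt_min one_pos (by positivity)
  have hdiam : 0 ≤ Metric.diam Φ.X := Metric.diam_nonneg
  -- Stopping at r / D makes the cylinder's diameter at most r / 2; the added 1 ensures D ≥ 1, hence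
  -- r / D ≤ 1.
  set D := 2 * (Metric.diam Φ.X + 1) with hD
  have hD0 : 1 ≤ D := by linarith
  have hDh : 0 < D ^ h := Real.rpow_pos_of_pos (by positivity) h
  refine ⟨((K ^ h) ^ 2)⁻¹ * (c₁ / D ^ h / M), by positivity, fun x hx r hr hr1 => ?_⟩
  have hs : 0 < r / D := by positivity
  have hs1 : r / D ≤ 1 := (div_le_one (by positivity)).2 (hr1.trans hD0)
  obtain ⟨m, hm⟩ := (hK.eventually_wordNorm_le hs).exists
  obtain ⟨τ, hτ⟩ := mem_iUnion.1 (Φ.limitSet_subset_level m hx)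
  obtain ⟨k, hkm, h1, -, h3⟩ := hK.exists_take_stopping hh hc hcl τ hs hs1 (hm τ)
  have hxσ := Φ.cylinder_subset_take hkm τ hτ
  set σ := Word.take hkm τ
  filter_upwards [eventually_ge_atTop k] with n hkn ν hprob hν
  refine le_trans (ENNReal.ofReal_le_ofReal ?_) ((hν.le_measure_cylinder hK hh hkn σ).trans
    (measure_mono fun y hy => ?_))
  · rw [mul_assoc]
    refine mul_le_mul_of_nonneg_left ?_ (by positivity)
    rw [Real.div_rpow hr.le (by positivity)] at h3
    calc c₁ / D ^ h / M * r ^ h = c₁ * (r ^ h / D ^ h) / M := by ring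
      _ ≤ Φ.wordNorm σ ^ h / M := by gcongr
      _ ≤ _ := div_le_div_of_nonneg_left (Real.rpow_nonneg (Φ.wordNorm_nonneg σ) h)
          (hK.Z_pos k h) (hM1 k)
  · rw [Metric.mem_closedBall]
    refine (hK.dist_le_of_mem_cylinder σ hy hxσ).trans
      ((mul_le_mul_of_nonneg_right h1 hdiam).trans ?_)
    rw [div_mul_eq_mul_div, div_le_div_iff₀ (by positivity) two_pos, hD]
    nlinarith

end Stopping

end ConformalNIFS

/-! ### Existence of cylinder measures and their weak limits. -/

namespace ConformalNIFS

variable {d : ℕ} {I : ℕ → Type u} {Φ : ConformalNIFS d I} [∀ n, Fintype (I n)]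
  [∀ n, Nonempty (I n)] [Nontrivial (EuclideanSpace ℝ (Fin d))] {K h : ℝ}

theorem DistortionBound.isAhlforsRegular_and_support_eq (hK : Φ.DistortionBound K)
    (hinj : Φ.IsInjective) (hosc : Φ.OpenSetCondition) (hh : 0 ≤ h)
    (hcard : BddAbove (Set.range fun n => Fintype.card (I n)))
    (hρ : BddAbove (Set.range fun n => Φ.ρ n))
    (hZ : BddAbove (Set.range fun n => Φ.Z n h))
    (hZinv : BddAbove (Set.range fun n => (Φ.Z n h)⁻¹))
    {ν : ℕ → ProbabilityMeasure (EuclideanSpace ℝ (Fin d))} {s : ℕ → ℕ}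
    {μ : ProbabilityMeasure (EuclideanSpace ℝ (Fin d))}
    (hν : ∀ n, Φ.IsCylinderMeasure h n (ν n : Measure (EuclideanSpace ℝ (Fin d))))
    (hs : StrictMono s) (hlim : Tendsto (fun k => ν (s k)) atTop (𝓝 μ)) :
    IsAhlforsRegular h (μ : Measure (EuclideanSpace ℝ (Fin d))) ∧
      (μ : Measure (EuclideanSpace ℝ (Fin d))).support = Φ.limitSet := by
  obtain ⟨c, hc, hcl⟩ := hK.exists_le_rpow_letterNorm hh hcard hρ hZ hZinv
  obtain ⟨C, hC, hupper⟩ := hK.exists_measure_ball_le hinj hosc hh hc hcl hZinv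
  obtain ⟨b, hb, hlower⟩ := hK.exists_le_measure_closedBall hh hc hcl hZ
  have hup : ∀ (x : EuclideanSpace ℝ (Fin d)) (r : ℝ), 0 < r → r ≤ 1 →
      (μ : Measure _) (Metric.ball x r) ≤ ENNReal.ofReal (C * r ^ h) := fun x r hr hr1 => by
    refine (ProbabilityMeasure.le_liminf_measure_open_of_tendsto hlim Metric.isOpen_ball).trans ?_
    refine liminf_le_of_frequently_le' (Eventually.frequently ?_)
    filter_upwards [hs.tendsto_atTop.eventually (hupper x r hr hr1)] with k hk using hk _ (hν _)
  have hlow : ∀ x ∈ Φ.limitSet, ∀ r : ℝ, 0 < r → r ≤ 1 →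
      ENNReal.ofReal (b * r ^ h) ≤ (μ : Measure _) (Metric.ball x r) := fun x hx r hr hr1 => by
    -- Lower bounds survive weak limits on closed sets only, hence the smaller closed ball.
    refine le_trans ?_ (measure_mono (Metric.closedBall_subset_ball (half_lt_self hr)))
    refine le_trans ?_ (ProbabilityMeasure.limsup_measure_closed_le_of_tendsto hlim
      Metric.isClosed_closedBall)
    refine le_limsup_of_frequently_le' (Eventually.frequently ?_)
    filter_upwards [hs.tendsto_atTop.eventually (hlower x hx r hr hr1)] with k hk
      using hk _ inferInstance (hν _)
  have hsupp : (μ : Measure (EuclideanSpace ℝ (Fin d))).support = Φ.limitSet := by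
    refine Subset.antisymm (fun x hx => Φ.mem_limitSet_iff.2 fun n => ?_) fun x hx => ?_
    · refine Measure.support_subset_of_isClosed (Φ.isCompact_level n).isClosed ?_ hx
      -- By nesting, all later measures of the subsequence give the closed level n full mass.
      have hone : (μ : Measure _) (Φ.level n) = 1 := by
        refine le_antisymm prob_le_one (le_trans ?_
          (ProbabilityMeasure.limsup_measure_closed_le_of_tendsto hlim
            (Φ.isCompact_level n).isClosed))
        refine le_limsup_of_frequently_le' (Eventually.frequently ?_)
        filter_upwards [eventually_ge_atTop n] with k hk
        have h1 : (ν (s k) : Measure _) (Φ.level (s k)) = 1 :=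
          (prob_compl_eq_zero_iff (Φ.isCompact_level _).measurableSet).1 (hν (s k)).1
        rw [← h1]
        exact measure_mono (Φ.level_antitone (hk.trans (hs.id_le k)))
      rw [mem_ae_iff]
      exact (prob_compl_eq_zero_iff (Φ.isCompact_level n).measurableSet).2 hone
    · rw [Metric.nhds_basis_ball.mem_measureSupport]
      intro r hr
      have hmin : 0 < min r 1 := lt_min hr one_pos
      refine lt_of_lt_of_le ?_ ((hlow x hx _ hmin (min_le_right _ _)).trans
        (measure_mono (Metric.ball_subset_ball (min_le_left _ _))))
      exact ENNReal.ofReal_pos.2 (mul_pos hb (Real.rpow_pos_of_pos hmin h))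
  refine ⟨⟨max C b⁻¹, hC.trans (le_max_left _ _), fun x hx r hr hr1 => ⟨?_, ?_⟩⟩, hsupp⟩
  · refine le_trans (ENNReal.ofReal_le_ofReal ?_) (hlow x (hsupp ▸ hx) r hr hr1)
    refine mul_le_mul_of_nonneg_right ?_ (Real.rpow_nonneg hr.le h)
    exact inv_le_of_inv_le₀ hb (le_max_right _ _)
  · refine (hup x r hr hr1).trans (ENNReal.ofReal_le_ofReal ?_)
    exact mul_le_mul_of_nonneg_right (le_max_left _ _) (Real.rpow_nonneg hr.le h)

/-- Weighted point masses at the images of one interior point of X work: each image lies in its own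
cylinder and in no other of that level. -/
theorem DistortionBound.exists_isCylinderMeasure (hK : Φ.DistortionBound K)
    (hinj : Φ.IsInjective) (hosc : Φ.OpenSetCondition) (h : ℝ) (n : ℕ) :
    ∃ ν : ProbabilityMeasure (EuclideanSpace ℝ (Fin d)),
      Φ.IsCylinderMeasure h n (ν : Measure (EuclideanSpace ℝ (Fin d))) := by
  obtain ⟨x, hx⟩ := Φ.interior_X_nonempty
  let ν : Measure (EuclideanSpace ℝ (Fin d)) := ∑ ω : Word I n,
    ENNReal.ofReal (Φ.wordNorm ω ^ h / Φ.Z n h) • Measure.dirac (Φ.wordMap n ω x)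
  have happly : ∀ A : Set (EuclideanSpace ℝ (Fin d)), ν A = ∑ ω : Word I n,
      ENNReal.ofReal (Φ.wordNorm ω ^ h / Φ.Z n h) * A.indicator 1 (Φ.wordMap n ω x) := by
    intro A
    simp [ν, Measure.dirac_apply]
  have hmem : ∀ ω : Word I n, Φ.wordMap n ω x ∈ Φ.cylinder n ω := fun ω =>
    mem_image_of_mem _ (interior_subset hx)
  refine ⟨⟨ν, ⟨?_⟩⟩, ?_, fun τ => ?_⟩
  · simp only [happly, indicator_univ, Pi.one_apply, mul_one]
    rw [← ENNReal.ofReal_sum_of_nonneg fun ω _ => weight_nonneg ω, hK.sum_weight_eq_one,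
      ENNReal.ofReal_one]
  · change ν _ = 0
    rw [happly]
    refine Finset.sum_eq_zero fun ω _ => ?_
    rw [indicator_of_notMem (notMem_compl_iff.2 (mem_iUnion.2 ⟨ω, hmem ω⟩)), mul_zero]
  · change ν _ = _
    rw [happly, Finset.sum_eq_single τ]
    · rw [indicator_of_mem (hmem τ), Pi.one_apply, mul_one]
      rfl
    · intro ω _ hne
      rw [indicator_of_notMem (hK.notMem_cylinder hinj hosc hne hx), mul_zero]
    · exact fun hτ => absurd (Finset.mem_univ τ) hτ

omit [∀ n, Nonempty (I n)] [Nontrivial (EuclideanSpace ℝ (Fin d))] in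
-- All these measures live on the compact set X, so they form a tight family.
theorem exists_tendsto_subseq_of_isCylinderMeasure
    {ν : ℕ → ProbabilityMeasure (EuclideanSpace ℝ (Fin d))}
    (hν : ∀ n, Φ.IsCylinderMeasure h n (ν n : Measure (EuclideanSpace ℝ (Fin d)))) :
    ∃ (s : ℕ → ℕ) (μ : ProbabilityMeasure (EuclideanSpace ℝ (Fin d))),
      StrictMono s ∧ Tendsto (fun k => ν (s k)) atTop (𝓝 μ) := by
  have hcomp := isCompact_setOfPred_probabilityMeasure_mass_eq_compl_isCompact_le
    (u := fun _ => 0) (K := fun _ => Φ.X) tendsto_const_nhds (fun _ => Φ.isCompact_X)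
    (Or.inl inferInstance)
  obtain ⟨μ, -, s, hs, hlim⟩ := hcomp.tendsto_subseq (x := ν) fun n _ => by
    have h1 : (ν n : Measure (EuclideanSpace ℝ (Fin d))) Φ.Xᶜ = 0 :=
      measure_mono_null (compl_subset_compl.2 (Φ.level_subset_X n)) (hν n).1
    rw [← ENNReal.coe_le_coe, ProbabilityMeasure.ennreal_coeFn_eq_coeFn_toMeasure, h1]
    simp
  exact ⟨s, μ, hs, hlim⟩

end ConformalNIFS

theorem mainTheorem4 {d : ℕ} (hd : 1 ≤ d) {I : ℕ → Type u}
    [∀ n, Fintype (I n)] [∀ n, Nonempty (I n)]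
    (Φ : ConformalNIFS d I) (hinj : Φ.IsInjective) (hosc : Φ.OpenSetCondition)
    (hbdp : Φ.BoundedDistortion) (h : ℝ) (hh : 0 ≤ h)
    (hcard : BddAbove (Set.range fun n => Fintype.card (I n)))
    (hρ : BddAbove (Set.range fun n => Φ.ρ n))
    (hZ : BddAbove (Set.range fun n => Φ.Z n h))
    (hZinv : BddAbove (Set.range fun n => (Φ.Z n h)⁻¹)) :
    (∃ (ν : ℕ → ProbabilityMeasure (EuclideanSpace ℝ (Fin d)))
        (s : ℕ → ℕ) (μ : ProbabilityMeasure (EuclideanSpace ℝ (Fin d))),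
      (∀ n, Φ.IsCylinderMeasure h n (ν n : Measure (EuclideanSpace ℝ (Fin d)))) ∧
      StrictMono s ∧ Tendsto (fun k => ν (s k)) atTop (𝓝 μ) ∧
      IsAhlforsRegular h (μ : Measure (EuclideanSpace ℝ (Fin d))) ∧
      (μ : Measure (EuclideanSpace ℝ (Fin d))).support = Φ.limitSet) ∧
    (∀ (ν : ℕ → ProbabilityMeasure (EuclideanSpace ℝ (Fin d)))
        (s : ℕ → ℕ) (μ : ProbabilityMeasure (EuclideanSpace ℝ (Fin d))),
      (∀ n, Φ.IsCylinderMeasure h n (ν n : Measure (EuclideanSpace ℝ (Fin d)))) →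
      StrictMono s → Tendsto (fun k => ν (s k)) atTop (𝓝 μ) →
      IsAhlforsRegular h (μ : Measure (EuclideanSpace ℝ (Fin d))) ∧
      (μ : Measure (EuclideanSpace ℝ (Fin d))).support = Φ.limitSet) := by
  obtain ⟨K, hK⟩ := hbdp
  have hK : Φ.DistortionBound K := hK
  have : NeZero d := ⟨Nat.one_le_iff_ne_zero.1 hd⟩
  have : Nontrivial (EuclideanSpace ℝ (Fin d)) := inferInstance
  have hmain := fun (ν : ℕ → ProbabilityMeasure (EuclideanSpace ℝ (Fin d))) (s : ℕ → ℕ)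
    (μ : ProbabilityMeasure (EuclideanSpace ℝ (Fin d)))
    (hν : ∀ n, Φ.IsCylinderMeasure h n (ν n : Measure (EuclideanSpace ℝ (Fin d))))
    (hs : StrictMono s) (hlim : Tendsto (fun k => ν (s k)) atTop (𝓝 μ)) =>
    hK.isAhlforsRegular_and_support_eq hinj hosc hh hcard hρ hZ hZinv hν hs hlim
  refine ⟨?_, hmain⟩
  choose ν hν using hK.exists_isCylinderMeasure hinj hosc h
  obtain ⟨s, μ, hs, hlim⟩ := ConformalNIFS.exists_tendsto_subseq_of_isCylinderMeasure hν
  exact ⟨ν, s, μ, hν, hs, hlim, hmain ν s μ hν hs hlim⟩
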